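/- Let $m\ge 0$ and $k$ be integers, and let $\mathcal{G}$ be a set of colored chains $(c_1\prec c_2\prec\dots\prec c_\ell)$ with colors $c_j\in\{1,\dots,m\}$ and lengths $2\le \ell\le k$. Assume that for every color $i$ the set $\mathcal{G}$ contains a monochromatic chain $(i\prec i\prec\dots\prec i)$. Let $\overline\beta=(\beta_1,\dots,\beta_m)$ be positive real numbers. A colored subset of $\mathcal{P}([n])$ is a set $S\subseteq\mathcal{P}([n])$ with a coloring $c:S\to\{1,\dots,m\}$. It is valid if there are no $(c_1\prec\dots\prec c_\ell)\in\mathcal{G}$ and $x_1\subsetneq x_2\subsetneq\dots\subsetneq x_\ell$ in $S$ with $c(x_j)=c_j$ for all $j$. Let $\Lambda(\mathcal{G},n)$ be the collection of valid colored subsets of $\mathcal{P}([n])$, and put $$\mu(\overline\beta,\Lambda(\mathcal{G},n))=\sum_{(S,c)\in\Lambda(\mathcal{G},n)}\ \prod_{x\in S}\beta_{c(x)}.$$ A template on $\mathcal{P}([n])$ is a function $T:\mathcal{P}([n])\to\mathcal{P}(\{1,\dots,m\})$. Its support is $\{x: T(x)\ne\emptyset\}$, and it is supported on $A$ if $A$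 contains its support. It is valid if every coloring of its support that gives each $x$ a color in $T(x)$ is valid. Its weighted entropy is $\omega(\overline\beta,T)=\sum_{x\in\mathcal{P}([n])}\log\bigl(1+\sum_{i\in T(x)}\beta_i\bigr)$. Then, as $T$ ranges over the valid templates on $\mathcal{P}([N])$, for all $N\ge 0$, that are supported on a chain of $\mathcal{P}([N])$, the maximum $$\omega_{crit}(\overline\beta)=\max_T\ \omega(\overline\beta,T)$$ exists, and, as $n\to\infty$ with $m,\mathcal{G},\overline\beta$ fixed, $$\mu(\overline\beta,\Lambda(\mathcal{G},n))=e^{\omega_{crit}(\overline\beta)\binom{n}{\lfloor n/2\rfloor}(1+o(1))}.$$ -/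

import Mathlib

open Filter Topology

namespace ColoredChains

/-- The Boolean lattice `𝒫([n])`, ordered by inclusion. -/
abbrev Cube (n : ℕ) : Type := Finset (Fin n)

/-- A colored subset of `𝒫([n])` with `m` colors: a set `S` with a coloring `S → [m]`,
encoded as the partial function which is `none` exactly outside of `S`. -/
abbrev ColoredSubset (m n : ℕ) : Type := Cube n → Option (Fin m)

/-- A colored chain `c₁ ≺ c₂ ≺ ⋯ ≺ c_ℓ` is the list of its colors, from bottom to top. It appears
in a colored subset if there are sets `x₁ ⊂ x₂ ⊂ ⋯ ⊂ x_ℓ` in it such that `x_j` has color `c_j`. -/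
def Appears {m n : ℕ} (g : List (Fin m)) (c : ColoredSubset m n) : Prop :=
  ∃ x : Fin g.length → Cube n, StrictMono x ∧ ∀ j, c (x j) = some (g.get j)

/-- A colored subset is valid if no forbidden colored chain appears in it. -/
def IsValid {m n : ℕ} (G : Set (List (Fin m))) (c : ColoredSubset m n) : Prop :=
  ∀ g ∈ G, ¬ Appears g c

/-- `G` contains a monochromatic chain of every color. -/
def IsSparse {m : ℕ} (G : Set (List (Fin m))) : Prop :=
  ∀ i : Fin m, ∃ l : ℕ, List.replicate l i ∈ G

/-- The collection `Λ(G, n)` of valid colored subsets of `𝒫([n])`. -/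
noncomputable def validSubsets {m : ℕ} (G : Set (List (Fin m))) (n : ℕ) :
    Finset (ColoredSubset m n) :=
  (Set.toFinite {c : ColoredSubset m n | IsValid G c}).toFinset

/-- The weight of one colored subset: the product of `β (color of x)` over its elements `x`
(elements outside of the subset contribute the factor `1`). -/
def weight {m n : ℕ} (β : Fin m → ℝ) (c : ColoredSubset m n) : ℝ :=
  ∏ x : Cube n, (c x).elim 1 β

/-- The `β`-weighted measure of a collection of colored subsets. -/
def measure {m n : ℕ} (β : Fin m → ℝ) (Λ : Finset (ColoredSubset m n)) : ℝ :=
  ∑ c ∈ Λ, weight β c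

/-- A template on `𝒫([n])`: a set of colors at each element. -/
abbrev Template (m n : ℕ) : Type := Cube n → Finset (Fin m)

namespace Template

variable {m n : ℕ}

/-- `T` is supported on `A` if `T x = ∅` for every `x ∉ A`. -/
def SupportedOn (T : Template m n) (A : Set (Cube n)) : Prop :=
  ∀ x, x ∉ A → T x = ∅

/-- The smallest set on which `T` is supported. -/
def supp (T : Template m n) : Set (Cube n) := {x | T x ≠ ∅}

/-- `c` is a coloring of exactly `supp T`, which gives each `x ∈ supp T` a color in `T x`. -/
def IsColoring (T : Template m n) (c : ColoredSubset m n) : Prop :=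
  (∀ x ∈ T.supp, ∃ i ∈ T x, c x = some i) ∧ ∀ x ∉ T.supp, c x = none

/-- A template is valid if each coloring of its support with colors from it is valid. -/
def Valid (G : Set (List (Fin m))) (T : Template m n) : Prop :=
  ∀ c : ColoredSubset m n, T.IsColoring c → IsValid G c

/-- The weighted entropy `ω(β, T)`. -/
noncomputable def entropy (β : Fin m → ℝ) (T : Template m n) : ℝ :=
  ∑ x : Cube n, Real.log (1 + ∑ i ∈ T x, β i)

end Template

/-- The values `ω(β, T)`, for `T` a valid template (on `𝒫([n])` for any `n`) supported on
a chain. -/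
def chainEntropies {m : ℕ} (G : Set (List (Fin m))) (β : Fin m → ℝ) : Set ℝ :=
  {w | ∃ (n : ℕ) (T : Template m n), T.Valid G ∧
    (∃ A : Set (Cube n), IsChain (· ⊆ ·) A ∧ T.SupportedOn A) ∧ w = T.entropy β}

/-- The critical exponent `ω_crit(β)`. -/
noncomputable def omegaCrit {m : ℕ} (G : Set (List (Fin m))) (β : Fin m → ℝ) : ℝ :=
  sSup (chainEntropies G β)

end ColoredChains

/-!
For the lower bound, the colors of an optimal template supported on a chain are spread over the
layers of `𝒫([n])` from the middle one upwards. There are boundedly many of these layers, and all of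
them have size asymptotic to `n.choose (n / 2)`.

For the upper bound, the color of an element `x` of a colored subset is refined by the set of the
words of colors which occur on the chains above `x`. In terms of refined colors, validity only
forbids pairs of comparable elements, so that valid colored subsets become independent sets of a
graph. The algorithm of Kleitman and Winston covers these sets by few containers, whose induced
subgraphs have small maximal degree. In such a container, the elements on a random maximal chain
contain few conflicting pairs on average. Without conflicts, these elements would form a valid
template of entropy at most `omegaCrit G β`, and an entropy bound for the elements on a random
maximal chain bounds the entropy of the whole container as in the LYM inequality.
-/

namespace ColoredChains

open Finset Numbering
open scoped Nat BigOperators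

/-! ### Random maximal chains -/

section Numberings

variable {X : Type*} [Fintype X] {s t : Finset X}

theorem isChain_setOf_isPrefix (f : Numbering X) : IsChain (· ⊆ ·) {s | f.IsPrefix s} :=
  fun s hs t ht _ ↦ (Nat.le_total #s #t).imp (hs.subset_of_card_le_card ht)
    (ht.subset_of_card_le_card hs)

variable [DecidableEq X]

theorem card_subtype_mem_compl (hst : s ⊆ t) : #(t.subtype (· ∈ sᶜ)) = #t - #s := by
  rw [← card_sdiff_of_subset hst, card_subtype, sdiff_eq_filter]
  simp only [mem_compl]

theorem isPrefix_iff_isPrefix_prefixedEquiv (hst : s ⊆ t) (f : prefixed s) :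
    f.1.IsPrefix t ↔ (prefixedEquiv s f).2.IsPrefix (t.subtype (· ∈ sᶜ)) := by
  have hle : #s ≤ #t := card_le_card hst
  have hs := mem_prefixed.1 f.2
  have hval (x : ↥sᶜ) : (((prefixedEquiv s f).2 x : Fin _) : ℕ) = f.1 x - #s := rfl
  simp only [IsPrefix, card_subtype_mem_compl hst, hval, mem_subtype, Subtype.forall, mem_compl]
  refine ⟨fun h x hx ↦ ?_, fun h x ↦ ?_⟩
  · have := (hs x).not.1 hx
    rw [h]
    lia
  · by_cases hx : x ∈ s
    · simp only [hst hx, true_iff]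
      exact ((hs x).1 hx).trans_le hle
    · have := (hs x).not.1 hx
      rw [h x hx]
      lia

theorem card_prefixed_inter_prefixed (hst : s ⊆ t) :
    #(prefixed s ∩ prefixed t) = (#s)! * ((#t - #s)! * (Fintype.card X - #t)!) := by
  have hle : #s ≤ #t := card_le_card hst
  calc #(prefixed s ∩ prefixed t)
      = #((prefixed t).subtype (· ∈ prefixed s)) := by
        rw [card_subtype, filter_mem_eq_inter, inter_comm]
    _ = #(univ ×ˢ prefixed (t.subtype (· ∈ sᶜ)) : Finset (Numbering s × Numbering ↥sᶜ)) :=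
        card_equiv (prefixedEquiv s) fun f ↦ by
          simp only [mem_subtype, mem_prefixed, mem_product, mem_univ, true_and]
          exact isPrefix_iff_isPrefix_prefixedEquiv hst f
    _ = (#s)! * ((#t - #s)! * (Fintype.card X - #t)!) := by
        rw [card_product, card_univ, Fintype.card_numbering, card_prefixed, Fintype.card_coe,
          Fintype.card_coe, card_compl,
          card_subtype_mem_compl hst, Nat.sub_sub, Nat.add_sub_cancel' hle]

theorem le_choose {n k : ℕ} (hk : 0 < k) (hkn : k < n) : n ≤ n.choose k := by
  induction n generalizing k with
  | zero => lia
  | succ n ih =>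
    obtain ⟨k, rfl⟩ := Nat.exists_eq_add_of_lt hk
    rw [zero_add, Nat.choose_succ_succ]
    have hpos : 0 < n.choose k := Nat.choose_pos (by lia)
    obtain hlt | rfl : k + 1 < n ∨ n = k + 1 := by lia
    · have := ih k.succ_pos hlt
      lia
    · simp

theorem add_mul_factorial_mul_factorial_le {i j : ℕ} (hi : 0 < i) (hj : 0 < j) :
    (i + j) * (i ! * j !) ≤ (i + j)! := by
  rw [← Nat.add_choose_mul_factorial_mul_factorial, mul_assoc]
  exact Nat.mul_le_mul_right _ (le_choose hj (Nat.lt_add_of_pos_left hi))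

/-- Among the numberings with prefix `t`, the proportion with prefix `s` is at most `1 / #t`, and
among those with prefix `s`, the proportion with prefix `t` is at most `1 / (card X - #s)`. -/
theorem card_mul_card_prefixed_inter_le (hs : s.Nonempty) (hst : s ⊂ t) (ht : t ≠ univ) :
    Fintype.card X * #(prefixed s ∩ prefixed t) ≤ #(prefixed s) + #(prefixed t) := by
  have hs0 : 0 < #s := hs.card_pos
  have hlt : #s < #t := card_lt_card hst
  have htX : #t < Fintype.card X := (card_lt_iff_ne_univ t).2 ht
  rw [card_prefixed_inter_prefixed hst.subset, card_prefixed, card_prefixed]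
  have below := add_mul_factorial_mul_factorial_le hs0 (Nat.sub_pos_of_lt hlt)
  have above := add_mul_factorial_mul_factorial_le (Nat.sub_pos_of_lt hlt)
    (Nat.sub_pos_of_lt htX)
  rw [show #s + (#t - #s) = #t by lia] at below
  rw [show #t - #s + (Fintype.card X - #t) = Fintype.card X - #s by lia] at above
  calc Fintype.card X * ((#s)! * ((#t - #s)! * (Fintype.card X - #t)!))
      ≤ (Fintype.card X - #s + #t) * ((#s)! * ((#t - #s)! * (Fintype.card X - #t)!)) :=
        Nat.mul_le_mul_right _ (by lia)
    _ = (#s)! * ((Fintype.card X - #s) * ((#t - #s)! * (Fintype.card X - #t)!)) +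
          #t * ((#s)! * (#t - #s)!) * (Fintype.card X - #t)! := by ring
    _ ≤ (#s)! * (Fintype.card X - #s)! + (#t)! * (Fintype.card X - #t)! := by gcongr

theorem expect_ite_isPrefix (s : Finset X) (a : ℝ) :
    𝔼 f : Numbering X, (if f.IsPrefix s then a else 0) = a / (Fintype.card X).choose #s := by
  have hind (f : Numbering X) :
      (if f.IsPrefix s then a else 0) = Set.indicator (prefixed s) 1 f * a := by
    simp [Set.indicator_apply]
  simp_rw [hind, ← expect_mul, expect_indicator_one, dens_prefixed, NNRat.cast_inv,
    NNRat.cast_natCast, inv_mul_eq_div]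

theorem sum_le_choose_middle_mul_expect {ψ : Finset X → ℝ} (hψ : ∀ x, 0 ≤ ψ x) :
    ∑ x, ψ x ≤ (Fintype.card X).choose (Fintype.card X / 2) *
      𝔼 f : Numbering X, ∑ x with f.IsPrefix x, ψ x := by
  simp_rw [sum_filter, expect_sum_comm, expect_ite_isPrefix, mul_sum, mul_div_left_comm]
  refine sum_le_sum fun x _ ↦ le_mul_of_one_le_right (hψ x) ((one_le_div ?_).2 ?_)
  · exact_mod_cast Nat.choose_pos x.card_le_univ
  · exact_mod_cast Nat.choose_le_middle _ _

end Numberings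

/-! ### Middle binomial coefficients -/

section Binomials

theorem sixteen_pow_le_mul_centralBinom_sq (n : ℕ) :
    16 ^ n ≤ (4 * n + 1) * n.centralBinom ^ 2 := by
  induction n with
  | zero => simp
  | succ n ih =>
    refine Nat.le_of_mul_le_mul_left (c := (n + 1) ^ 2) ?_ (by positivity)
    calc (n + 1) ^ 2 * 16 ^ (n + 1) = 16 * (n + 1) ^ 2 * 16 ^ n := by ring
      _ ≤ 16 * (n + 1) ^ 2 * ((4 * n + 1) * n.centralBinom ^ 2) := by gcongr
      _ = 4 * ((4 * n + 1) * (2 * n + 2) ^ 2) * n.centralBinom ^ 2 := by ring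
      _ ≤ 4 * ((4 * n + 5) * (2 * n + 1) ^ 2) * n.centralBinom ^ 2 := by
        gcongr ?_ * _
        lia
      _ = (4 * (n + 1) + 1) * (2 * (2 * n + 1) * n.centralBinom) ^ 2 := by ring
      _ = (n + 1) ^ 2 * ((4 * (n + 1) + 1) * (n + 1).centralBinom ^ 2) := by
        rw [← Nat.succ_mul_centralBinom_succ]
        ring

theorem four_pow_le_mul_choose_middle_sq (n : ℕ) :
    4 ^ n ≤ (2 * n + 3) * n.choose (n / 2) ^ 2 := by
  obtain ⟨j, rfl | rfl⟩ := Nat.even_or_odd' n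
  · have h := sixteen_pow_le_mul_centralBinom_sq j
    rw [Nat.centralBinom] at h
    rw [Nat.mul_div_cancel_left _ two_pos, pow_mul]
    exact h.trans (Nat.mul_le_mul_right _ (by lia))
  · have h := sixteen_pow_le_mul_centralBinom_sq (j + 1)
    have hodd : (j + 1).centralBinom = 2 * (2 * j + 1).choose j := by
      rw [Nat.centralBinom, mul_add_one, Nat.choose_succ_succ, Nat.choose_symm_half]
      ring
    rw [show (2 * j + 1) / 2 = j by lia, pow_succ, pow_mul]
    rw [hodd, pow_succ, mul_pow] at h
    lia

theorem two_pow_le_sqrt_mul_choose_middle (n : ℕ) :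
    (2 : ℝ) ^ n ≤ √(2 * n + 3) * n.choose (n / 2) := by
  refine le_of_sq_le_sq ?_ (by positivity)
  rw [mul_pow, Real.sq_sqrt (by positivity), pow_right_comm]
  norm_num only
  exact_mod_cast four_pow_le_mul_choose_middle_sq n

theorem tendsto_sub_half_add_div_half_add (a : ℕ) :
    Tendsto (fun n : ℕ ↦ ((n - (n / 2 + a) : ℕ) : ℝ) / (n / 2 + a + 1 : ℕ)) atTop (𝓝 1) := by
  have hden : Tendsto (fun n : ℕ ↦ n / 2 + a + 1) atTop atTop :=
    tendsto_atTop_mono (fun n ↦ by lia) (Nat.tendsto_div_const_atTop two_ne_zero)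
  have hlim : Tendsto (fun n : ℕ ↦ (2 * a + 1 : ℝ) / (n / 2 + a + 1 : ℕ)) atTop (𝓝 0) :=
    tendsto_const_nhds.div_atTop (tendsto_natCast_atTop_atTop.comp hden)
  rw [tendsto_iff_dist_tendsto_zero]
  refine squeeze_zero' (.of_forall fun _ ↦ dist_nonneg) ?_ hlim
  filter_upwards [eventually_ge_atTop (2 * a)] with n hn
  have hpos : (0 : ℝ) < (n / 2 + a + 1 : ℕ) := by positivity
  rw [Real.dist_eq, div_sub_one hpos.ne', abs_div, abs_of_pos hpos]
  gcongr
  rw [abs_sub_le_iff, sub_le_iff_le_add, sub_le_iff_le_add]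
  norm_cast
  lia

theorem tendsto_choose_div_choose_middle (a : ℕ) :
    Tendsto (fun n : ℕ ↦ (n.choose (n / 2 + a) : ℝ) / n.choose (n / 2)) atTop (𝓝 1) := by
  induction a with
  | zero =>
    refine tendsto_const_nhds.congr fun n ↦ ?_
    have : (n.choose (n / 2) : ℝ) ≠ 0 := mod_cast (Nat.choose_pos (Nat.div_le_self n 2)).ne'
    rw [add_zero, div_self this]
  | succ a ih =>
    have hmul := ih.mul (tendsto_sub_half_add_div_half_add a)
    rw [one_mul] at hmul
    refine hmul.congr fun n ↦ ?_
    have hsucc : (n.choose (n / 2 + a) : ℝ) * (n - (n / 2 + a) : ℕ) =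
        n.choose (n / 2 + a + 1) * (n / 2 + a + 1 : ℕ) :=
      mod_cast (Nat.choose_succ_right_eq n (n / 2 + a)).symm
    rw [div_mul_div_comm, hsucc, mul_div_mul_right _ _ (by positivity), add_assoc]

theorem tendsto_choose_middle_atTop :
    Tendsto (fun n : ℕ ↦ (n.choose (n / 2) : ℝ)) atTop atTop := by
  refine tendsto_natCast_atTop_atTop.comp ?_
  refine tendsto_atTop_mono' _ ?_ tendsto_id
  filter_upwards [eventually_ge_atTop 2] with n hn
  exact le_choose (Nat.div_pos hn two_pos) (Nat.div_lt_self (by lia) one_lt_two)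

end Binomials

/-! ### Weighted graph containers -/

section Containers

variable {ι V : Type*} [DecidableEq V] {Γ : SimpleGraph V} [DecidableRel Γ.Adj] {F : Finset ι}
  {I : ι → Finset V} {w : ι → ℝ}

theorem sum_subset_union_le (hI : ∀ c ∈ F, Γ.IsIndepSet (I c)) (hw : ∀ c ∈ F, 0 ≤ w c) (v : V)
    (A S : Finset V) :
    ∑ c ∈ F with I c ⊆ A ∪ S, w c ≤
      ∑ c ∈ F with I c ⊆ A.erase v ∪ S, w c +
        ∑ c ∈ F with I c ⊆ {u ∈ A.erase v | ¬Γ.Adj v u} ∪ insert v S, w c := by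
  classical
  rw [← sum_union_inter]
  refine le_add_of_le_of_nonneg (sum_le_sum_of_subset_of_nonneg ?_ ?_) (sum_nonneg ?_)
  · intro c hc
    obtain ⟨hcF, hcA⟩ := mem_filter.1 hc
    rw [mem_union, mem_filter, mem_filter]
    by_cases hv : v ∈ I c
    · refine .inr ⟨hcF, fun u hu ↦ ?_⟩
      have hadj (huv : v ≠ u) : ¬Γ.Adj v u := hI c hcF hv hu huv
      grind
    · exact .inl ⟨hcF, fun u hu ↦ by grind⟩
  · grind
  · grind

/-- The algorithm of Kleitman and Winston: as long as some vertex has more than `d` neighbors in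
`A`, branch over whether it belongs to the independent set. The gain in `(1 + t) ^ #A` from
discarding its neighbors pays for the loss of a factor `M`. -/
theorem sum_subset_union_le_mul_pow (hI : ∀ c ∈ F, Γ.IsIndepSet (I c)) (hw : ∀ c ∈ F, 0 ≤ w c)
    {d : ℕ} {E M t : ℝ} (hM : 1 ≤ M) (ht : 0 ≤ t) (hMt : M ≤ t * (1 + t) ^ d) {A : Finset V}
    (hE : ∀ B ⊆ A, (∀ v ∈ B, #{u ∈ B | Γ.Adj v u} ≤ d) → ∀ S,
      ∑ c ∈ F with I c ⊆ B ∪ S, w c ≤ E * M ^ #S) (S : Finset V) :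
    ∑ c ∈ F with I c ⊆ A ∪ S, w c ≤ E * M ^ #S * (1 + t) ^ #A := by
  have h1t : 1 ≤ 1 + t := le_add_of_nonneg_right ht
  have hE0 : 0 ≤ E := by
    simpa using (sum_nonneg fun c hc ↦ hw c (mem_of_mem_filter c hc)).trans
      (hE ∅ (empty_subset _) (by simp) ∅)
  induction A using Finset.strongInduction generalizing S with
  | H A ih =>
  by_cases hdeg : ∀ v ∈ A, #{u ∈ A | Γ.Adj v u} ≤ d
  · exact (hE A subset_rfl hdeg S).trans
      (le_mul_of_one_le_right (by positivity) (one_le_pow₀ h1t))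
  push Not at hdeg
  obtain ⟨v, hvA, hdv⟩ := hdeg
  set A' := A.erase v
  have hA' : A' ⊂ A := erase_ssubset hvA
  have hA'' : {u ∈ A' | ¬Γ.Adj v u} ⊂ A := (filter_subset _ _).trans_ssubset hA'
  have hcard' : #A' + 1 = #A := card_erase_add_one hvA
  have hnbr : ({u ∈ A' | Γ.Adj v u} : Finset V) = {u ∈ A | Γ.Adj v u} := by
    rw [filter_erase, erase_eq_of_notMem (by simp)]
  have hcard'' := card_filter_add_card_filter_not (s := A') (Γ.Adj v)
  rw [hnbr] at hcard''
  calc ∑ c ∈ F with I c ⊆ A ∪ S, w c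
      ≤ ∑ c ∈ F with I c ⊆ A' ∪ S, w c +
          ∑ c ∈ F with I c ⊆ {u ∈ A' | ¬Γ.Adj v u} ∪ insert v S, w c :=
        sum_subset_union_le hI hw v A S
    _ ≤ E * M ^ #S * (1 + t) ^ #A' +
          E * M ^ #(insert v S) * (1 + t) ^ #{u ∈ A' | ¬Γ.Adj v u} :=
        add_le_add (ih _ hA' (fun B hB ↦ hE B (hB.trans hA'.subset)) S)
          (ih _ hA'' (fun B hB ↦ hE B (hB.trans hA''.subset)) _)
    _ ≤ E * M ^ #S * (1 + t) ^ #A' + E * M ^ (#S + 1) * (1 + t) ^ (#A' - d) := by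
        gcongr
        · exact card_insert_le v S
        · lia
    _ = E * M ^ #S * ((1 + t) ^ #A' + M * (1 + t) ^ (#A' - d)) := by ring
    _ ≤ E * M ^ #S * ((1 + t) ^ #A' + t * (1 + t) ^ d * (1 + t) ^ (#A' - d)) := by gcongr
    _ = E * M ^ #S * ((1 + t) ^ #A' + t * (1 + t) ^ #A') := by
        rw [mul_assoc t, ← pow_add, Nat.add_sub_cancel' (by lia)]
    _ = E * M ^ #S * (1 + t) ^ #A := by
        rw [← hcard']
        ring

end Containers

/-! ### Conflicts between labeled elements of a partial order -/

section Conflicts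

variable {P κ : Type*} [PartialOrder P] (R : κ → κ → Prop)

/-- Pairs `(x, q)` consist of an element `x` and a label `q`. Two of them are adjacent if their
elements are comparable and the label of the smaller one stands in relation `R` to the label of the
larger one. -/
def conflictGraph : SimpleGraph (P × κ) := .fromRel fun u v ↦ u.1 < v.1 ∧ R u.2 v.2

open Classical in
/-- The edges inside `B` of the conflict graph, oriented upwards. -/
noncomputable def conflictPairs (B : Finset (P × κ)) : Finset ((P × κ) × P × κ) :=
  {e ∈ B ×ˢ B | e.1.1 < e.2.1 ∧ R e.1.2 e.2.2}

variable {R} {B : Finset (P × κ)}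

theorem conflictGraph_adj {u v : P × κ} :
    (conflictGraph R).Adj u v ↔ u.1 < v.1 ∧ R u.2 v.2 ∨ v.1 < u.1 ∧ R v.2 u.2 := by
  rw [conflictGraph, SimpleGraph.fromRel_adj, and_iff_right_of_imp]
  rintro (h | h) rfl <;> exact h.1.false

theorem mem_conflictPairs {e : (P × κ) × P × κ} :
    e ∈ conflictPairs R B ↔ (e.1 ∈ B ∧ e.2 ∈ B) ∧ e.1.1 < e.2.1 ∧ R e.1.2 e.2.2 := by
  classical
  simp only [conflictPairs, mem_filter, mem_product]

/-- On a chain, every pair except the lowest one with its label is the upper end of a conflict. -/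
theorem card_le_card_add_card_conflictPairs {Q : Finset κ} (hR : ∀ q ∈ Q, R q q)
    (hB : ∀ v ∈ B, v.2 ∈ Q) (hchain : IsChain (· ≤ ·) (Prod.fst '' (B : Set (P × κ)))) :
    #B ≤ #Q + #(conflictPairs R B) := by
  classical
  let IsLowest (v : P × κ) : Prop := ∀ u ∈ B, u.2 = v.2 → ¬u.1 < v.1
  have hlowest : #{v ∈ B | IsLowest v} ≤ #Q := by
    refine card_le_card_of_injOn Prod.snd (fun v hv ↦ hB v (mem_of_mem_filter v hv)) ?_
    intro u hu v hv huv
    obtain ⟨huB, hu⟩ := mem_filter.1 hu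
    obtain ⟨hvB, hv⟩ := mem_filter.1 hv
    refine Prod.ext (of_not_not fun hne ↦ ?_) huv
    exact (hchain ⟨u, huB, rfl⟩ ⟨v, hvB, rfl⟩ hne).elim (fun h ↦ hv u huB huv (h.lt_of_ne hne))
      fun h ↦ hu v hvB huv.symm (h.lt_of_ne' hne)
  have hrest : {v ∈ B | ¬IsLowest v} ⊆ (conflictPairs R B).image Prod.snd := by
    intro v hv
    simp only [IsLowest, mem_filter, not_forall, not_not] at hv
    obtain ⟨hvB, u, huB, huv, hlt⟩ := hv
    exact mem_image.2 ⟨(u, v), mem_conflictPairs.2 ⟨⟨huB, hvB⟩, hlt, by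
      simpa only [huv] using hR _ (hB v hvB)⟩, rfl⟩
  rw [← card_filter_add_card_filter_not (s := B) IsLowest]
  exact add_le_add hlowest ((card_le_card hrest).trans card_image_le)

open Classical in
theorem sum_conflictPairs_add (w : P × κ → ℕ) :
    ∑ e ∈ conflictPairs R B, (w e.1 + w e.2) =
      ∑ v ∈ B, #{u ∈ B | (conflictGraph R).Adj v u} * w v := by
  have hdeg (v : P × κ) : #{u ∈ B | (conflictGraph R).Adj v u} =
      #{u ∈ B | v.1 < u.1 ∧ R v.2 u.2} + #{u ∈ B | u.1 < v.1 ∧ R u.2 v.2} := by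
    simp_rw [conflictGraph_adj, filter_or]
    exact card_union_of_disjoint (disjoint_filter.2 fun u _ h h' ↦ h.1.asymm h'.1)
  simp_rw [hdeg, add_mul, sum_add_distrib, card_filter, sum_mul, ite_mul, one_mul, zero_mul]
  rw [conflictPairs, sum_filter, sum_filter, sum_product, sum_product_right]

variable {X : Type*} [Fintype X] [DecidableEq X]

open Classical in
theorem sum_card_conflictPairs_isPrefix (B : Finset (Finset X × κ)) :
    ∑ f : Numbering X, #(conflictPairs R {v ∈ B | f.IsPrefix v.1}) =
      ∑ e ∈ conflictPairs R B, #(prefixed e.1.1 ∩ prefixed e.2.1) := by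
  have hfilter (f : Numbering X) : conflictPairs R {v ∈ B | f.IsPrefix v.1} =
      {e ∈ conflictPairs R B | f ∈ prefixed e.1.1 ∩ prefixed e.2.1} := by
    ext e
    simp only [mem_conflictPairs, mem_filter, mem_inter, mem_prefixed]
    tauto
  simp_rw [hfilter, card_filter]
  rw [sum_comm]
  simp_rw [← card_filter, filter_univ_mem]

open Classical in
/-- The elements on a maximal chain outnumber the conflicts among them by at most `#Q`, while a
conflict lies on few of the maximal chains by `card_mul_card_prefixed_inter_le`. -/
theorem card_mul_sum_card_conflictPairs_le {B : Finset (Finset X × κ)}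
    {Q : Finset κ} {d : ℕ} (hR : ∀ q ∈ Q, R q q)
    (hB : ∀ v ∈ B, v.2 ∈ Q) (hB' : ∀ v ∈ B, v.1.Nonempty ∧ v.1 ≠ univ)
    (hdeg : ∀ v ∈ B, #{u ∈ B | (conflictGraph R).Adj v u} ≤ d) (hd : 2 * d ≤ Fintype.card X) :
    Fintype.card X * ∑ f : Numbering X, #(conflictPairs R {v ∈ B | f.IsPrefix v.1}) ≤
      2 * d * #Q * (Fintype.card X)! := by
  set S := ∑ f : Numbering X, #(conflictPairs R {v ∈ B | f.IsPrefix v.1}) with hS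
  have hpoints : ∑ f : Numbering X, #{v ∈ B | f.IsPrefix v.1} = ∑ v ∈ B, #(prefixed v.1) :=
    sum_card_bipartiteAbove_eq_sum_card_bipartiteBelow _
  have hlower : Fintype.card X * S ≤ d * ∑ v ∈ B, #(prefixed v.1) := by
    calc Fintype.card X * S
        ≤ ∑ e ∈ conflictPairs R B, (#(prefixed e.1.1) + #(prefixed e.2.1)) := by
          rw [hS, sum_card_conflictPairs_isPrefix, mul_sum]
          refine sum_le_sum fun e he ↦ ?_
          obtain ⟨⟨h₁, h₂⟩, hlt, -⟩ := mem_conflictPairs.1 he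
          exact card_mul_card_prefixed_inter_le (hB' _ h₁).1 hlt (hB' _ h₂).2
      _ = ∑ v ∈ B, #{u ∈ B | (conflictGraph R).Adj v u} * #(prefixed v.1) :=
          sum_conflictPairs_add fun v ↦ #(prefixed v.1)
      _ ≤ d * ∑ v ∈ B, #(prefixed v.1) := by
          rw [mul_sum]
          gcongr with v hv
          exact hdeg v hv
  have hupper : ∑ v ∈ B, #(prefixed v.1) ≤ #Q * (Fintype.card X)! + S := by
    have hf (f : Numbering X) :
        #{v ∈ B | f.IsPrefix v.1} ≤ #Q + #(conflictPairs R {v ∈ B | f.IsPrefix v.1}) := by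
      refine card_le_card_add_card_conflictPairs hR (fun v hv ↦ hB v (mem_of_mem_filter v hv)) ?_
      refine (isChain_setOf_isPrefix f).mono ?_
      rintro _ ⟨v, hv, rfl⟩
      exact (mem_filter.1 hv).2
    rw [← hpoints]
    refine (sum_le_sum fun f _ ↦ hf f).trans_eq ?_
    rw [sum_add_distrib, sum_const, card_univ, Fintype.card_numbering, smul_eq_mul, mul_comm]
  nlinarith

open Classical in
theorem expect_card_conflictPairs_le [Nonempty X] {B : Finset (Finset X × κ)} {Q : Finset κ} {d : ℕ}
    (hR : ∀ q ∈ Q, R q q) (hB : ∀ v ∈ B, v.2 ∈ Q) (hB' : ∀ v ∈ B, v.1.Nonempty ∧ v.1 ≠ univ)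
    (hdeg : ∀ v ∈ B, #{u ∈ B | (conflictGraph R).Adj v u} ≤ d) (hd : 2 * d ≤ Fintype.card X) :
    𝔼 f : Numbering X, (#(conflictPairs R {v ∈ B | f.IsPrefix v.1}) : ℝ) ≤
      2 * #Q * (d / Fintype.card X) := by
  have hsum := card_mul_sum_card_conflictPairs_le hR hB hB' hdeg hd
  have hcard : (0 : ℝ) < Fintype.card X := Nat.cast_pos.2 Fintype.card_pos
  rw [Fintype.expect_eq_sum_div_card, Fintype.card_numbering, div_le_iff₀ (by positivity),
    mul_div_assoc', div_mul_eq_mul_div, le_div_iff₀ hcard]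
  have hsum' : (Fintype.card X : ℝ) *
      ∑ f : Numbering X, (#(conflictPairs R {v ∈ B | f.IsPrefix v.1}) : ℝ) ≤
        2 * d * #Q * (Fintype.card X)! := by exact_mod_cast hsum
  linarith

end Conflicts

/-! ### Reduction of forbidden words to forbidden pairs of refined colors -/

section Words

variable {α : Type*} {G : Set (List α)}

/-- The word `p` has no subword in `G`. -/
def Avoids (G : Set (List α)) (p : List α) : Prop := ∀ g ∈ G, ¬g.Sublist p

theorem Avoids.sublist {p q : List α} (hq : Avoids G q) (h : p.Sublist q) : Avoids G p :=
  fun g hg hgp ↦ hq g hg (hgp.trans h)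

theorem Avoids.notMem {p : List α} (hp : Avoids G p) : p ∉ G := fun h ↦ hp p h (.refl p)

theorem finite_setOf_avoids [Finite α] (hsparse : ∀ i, ∃ l, List.replicate l i ∈ G) :
    {p | Avoids G p}.Finite := by
  classical
  have := Fintype.ofFinite α
  choose l hl using hsparse
  refine (List.finite_length_le α (∑ i, l i)).subset fun p hp ↦ ?_
  have hcount (i : α) : p.count i < l i :=
    not_le.1 fun h ↦ hp _ (hl i) (List.replicate_sublist_iff.2 h)
  calc p.length = ∑ i, p.count i := by
        simpa using (Multiset.sum_count_eq_card (m := (p : Multiset α)) fun i _ ↦ mem_univ i).symm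
    _ ≤ ∑ i, l i := sum_le_sum fun i _ ↦ (hcount i).le

/-- A refined color is a color together with a set of words. It stands for an element `x` of a
colored subset, with the words of colors of the chains strictly above `x`. -/
abbrev RefinedColor (α : Type*) : Type _ := α × Set (List α)

/-- The refined colors `q` and `r` cannot be those of elements `x < y` of a colored subset: if `p`
occurs above `y`, then `r.1 :: p` has to occur above `x`. -/
def Conflict (q r : RefinedColor α) : Prop := ∃ p ∈ r.2, r.1 :: p ∉ q.2

/-- The refined colors which may occur in a colored subset which is valid for `G`. -/
def admissible (G : Set (List α)) : Set (RefinedColor α) :=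
  {q | [] ∈ q.2 ∧ ∀ p ∈ q.2, Avoids G (q.1 :: p)}

theorem finite_admissible [Finite α] (hsparse : ∀ i, ∃ l, List.replicate l i ∈ G) :
    (admissible G).Finite :=
  (Set.finite_univ.prod (finite_setOf_avoids hsparse).finite_subsets).subset fun _ hq ↦
    ⟨Set.mem_univ _, fun p hp ↦ (hq.2 p hp).sublist (List.sublist_cons_self _ p)⟩

theorem conflict_self (hsparse : ∀ i, ∃ l, List.replicate l i ∈ G) {q : RefinedColor α}
    (hq : q ∈ admissible G) : Conflict q q := by
  by_contra hconf
  have hreplicate (l : ℕ) : List.replicate l q.1 ∈ q.2 := by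
    induction l with
    | zero => exact hq.1
    | succ l ih => exact of_not_not fun h ↦ hconf ⟨_, ih, h⟩
  obtain ⟨l, hl⟩ := hsparse q.1
  exact hq.2 _ (hreplicate l) _ hl (List.sublist_cons_self _ _)

theorem map_fst_mem_of_pairwise_not_conflict {q : RefinedColor α} {L : List (RefinedColor α)}
    (hpair : (q :: L).Pairwise fun r s ↦ ¬Conflict r s) (hnil : ∀ r ∈ q :: L, [] ∈ r.2) :
    L.map Prod.fst ∈ q.2 := by
  induction L generalizing q with
  | nil => exact hnil q List.mem_cons_self
  | cons r L ih =>
    have htail := ih hpair.of_cons fun s hs ↦ hnil s (List.mem_cons_of_mem q hs)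
    exact of_not_not fun h ↦ List.rel_of_pairwise_cons hpair List.mem_cons_self ⟨_, htail, h⟩

theorem avoids_map_fst {L : List (RefinedColor α)} (hL : L ≠ [])
    (hadm : ∀ q ∈ L, q ∈ admissible G) (hpair : L.Pairwise fun q r ↦ ¬Conflict q r) :
    Avoids G (L.map Prod.fst) := by
  obtain _ | ⟨q, L⟩ := L
  · contradiction
  · exact (hadm q List.mem_cons_self).2 _
      (map_fst_mem_of_pairwise_not_conflict hpair fun r hr ↦ (hadm r hr).1)

end Words

section Refinement

variable {m n : ℕ} {G : Set (List (Fin m))} {c : ColoredSubset m n}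

theorem Appears.of_sublist {p q : List (Fin m)} (hpq : p.Sublist q) (hq : Appears q c) :
    Appears p c := by
  obtain ⟨x, hx, hxc⟩ := hq
  obtain ⟨e, he⟩ := List.sublist_iff_exists_fin_orderEmbedding_get_eq.1 hpq
  exact ⟨x ∘ e, hx.comp e.strictMono, fun j ↦ by rw [Function.comp_apply, hxc, he]⟩

theorem IsValid.avoids (hc : IsValid G c) {p : List (Fin m)} (hp : Appears p c) : Avoids G p :=
  fun g hg hgp ↦ hc g hg (hp.of_sublist hgp)

/-- The words of colors of the chains of a colored subset strictly above `x`. -/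
def wordsAbove (c : ColoredSubset m n) (x : Cube n) : Set (List (Fin m)) :=
  {p | ∃ f : Fin p.length → Cube n, StrictMono f ∧ ∀ j, x < f j ∧ c (f j) = some (p.get j)}

theorem nil_mem_wordsAbove (x : Cube n) : [] ∈ wordsAbove c x :=
  ⟨Fin.elim0, fun j ↦ j.elim0, fun j ↦ j.elim0⟩

theorem exists_strictMono_of_mem_wordsAbove {x : Cube n} {i : Fin m} {p : List (Fin m)}
    (hx : c x = some i) (hp : p ∈ wordsAbove c x) :
    ∃ f : Fin (i :: p).length → Cube n, StrictMono f ∧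
      ∀ j, x ≤ f j ∧ c (f j) = some ((i :: p).get j) := by
  obtain ⟨f, hf, hfc⟩ := hp
  exact ⟨Fin.cons x f, (Fin.strictMono_cons (f := f)).2 ⟨fun j ↦ (hfc j).1, hf⟩,
    Fin.cases ⟨le_rfl, hx⟩ fun j ↦ ⟨(hfc j).1.le, (hfc j).2⟩⟩

theorem cons_mem_wordsAbove {x y : Cube n} (hxy : x < y) {i : Fin m} (hy : c y = some i)
    {p : List (Fin m)} (hp : p ∈ wordsAbove c y) : i :: p ∈ wordsAbove c x := by
  obtain ⟨f, hf, hfc⟩ := exists_strictMono_of_mem_wordsAbove hy hp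
  exact ⟨f, hf, fun j ↦ ⟨hxy.trans_le (hfc j).1, (hfc j).2⟩⟩

open Classical in
/-- The elements of a colored subset, labeled by their refined colors. -/
noncomputable def refinement (c : ColoredSubset m n) : Finset (Cube n × RefinedColor (Fin m)) :=
  univ.biUnion fun x ↦ (c x).toFinset.image fun i ↦ (x, i, wordsAbove c x)

theorem mem_refinement {v : Cube n × RefinedColor (Fin m)} :
    v ∈ refinement c ↔ c v.1 = some v.2.1 ∧ v.2.2 = wordsAbove c v.1 := by
  obtain ⟨x, i, W⟩ := v
  simp only [refinement, mem_biUnion, mem_univ, true_and, mem_image, Option.mem_toFinset,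
    Option.mem_def, Prod.mk.injEq]
  constructor
  · rintro ⟨x, i, h, rfl, rfl, rfl⟩
    exact ⟨h, rfl⟩
  · rintro ⟨h, rfl⟩
    exact ⟨x, i, h, rfl, rfl, rfl⟩

theorem isIndepSet_refinement :
    (conflictGraph Conflict).IsIndepSet (refinement c : Set (Cube n × RefinedColor (Fin m))) := by
  have hconf {u v : Cube n × RefinedColor (Fin m)} (hu : u ∈ refinement c) (hv : v ∈ refinement c)
      (huv : u.1 < v.1) : ¬Conflict u.2 v.2 := by
    rintro ⟨p, hp, hup⟩
    rw [(mem_refinement.1 hv).2] at hp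
    rw [(mem_refinement.1 hu).2] at hup
    exact hup (cons_mem_wordsAbove huv (mem_refinement.1 hv).1 hp)
  intro u hu v hv _ hadj
  obtain h | h := conflictGraph_adj.1 hadj
  · exact hconf hu hv h.1 h.2
  · exact hconf hv hu h.1 h.2

theorem snd_mem_admissible_of_mem_refinement (hc : IsValid G c)
    {v : Cube n × RefinedColor (Fin m)} (hv : v ∈ refinement c) : v.2 ∈ admissible G := by
  obtain ⟨hcolor, hwords⟩ := mem_refinement.1 hv
  refine ⟨hwords ▸ nil_mem_wordsAbove v.1, fun p hp ↦ hc.avoids ?_⟩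
  obtain ⟨f, hf, hfc⟩ := exists_strictMono_of_mem_wordsAbove hcolor (hwords ▸ hp)
  exact ⟨f, hf, fun j ↦ (hfc j).2⟩

end Refinement

/-! ### Valid templates and the maximum defining the critical exponent -/

section ColorEntropy

variable {α : Type*} {β : α → ℝ} {s t : Finset α}

/-- The contribution `log (1 + ∑ i ∈ s, β i)` of one element with set of colors `s` to the weighted
entropy of a template. -/
noncomputable def colorEntropy (β : α → ℝ) (s : Finset α) : ℝ := Real.log (1 + ∑ i ∈ s, β i)

theorem colorEntropy_empty : colorEntropy β ∅ = 0 := by simp [colorEntropy]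

theorem colorEntropy_mono (hβ : ∀ i, 0 ≤ β i) : Monotone (colorEntropy β) := fun s t hst ↦ by
  have hsum : 0 ≤ ∑ i ∈ s, β i := sum_nonneg fun i _ ↦ hβ i
  have hle : ∑ i ∈ s, β i ≤ ∑ i ∈ t, β i := sum_le_sum_of_subset_of_nonneg hst fun i _ _ ↦ hβ i
  exact Real.log_le_log (by linarith) (by linarith)

theorem colorEntropy_nonneg (hβ : ∀ i, 0 ≤ β i) (s : Finset α) : 0 ≤ colorEntropy β s :=
  colorEntropy_empty (β := β) ▸ colorEntropy_mono hβ (empty_subset s)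

theorem exp_colorEntropy (hβ : ∀ i, 0 ≤ β i) (s : Finset α) :
    Real.exp (colorEntropy β s) = 1 + ∑ i ∈ s, β i :=
  Real.exp_log (by linarith [sum_nonneg fun i (_ : i ∈ s) ↦ hβ i])

end ColorEntropy

theorem exists_strictMono_of_isChain {P : Type*} [PartialOrder P] {D : Finset P}
    (hD : IsChain (· ≤ ·) (D : Set P)) {l : ℕ} (hl : l ≤ #D) :
    ∃ x : Fin l → P, StrictMono x ∧ ∀ j, x j ∈ D := by
  classical
  let := hD.linearOrder
  let e := Finset.orderEmbOfCardLe (univ : Finset (D : Set P)) (k := l) (by simpa using hl)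
  exact ⟨fun j ↦ e j, fun i j hij ↦ e.strictMono hij, fun j ↦ (e j).2⟩

namespace Template

variable {m n : ℕ} {G : Set (List (Fin m))} {T : Template m n}

theorem IsColoring.mem {c : ColoredSubset m n} (hc : T.IsColoring c) {x : Cube n} {i : Fin m}
    (hx : c x = some i) : i ∈ T x := by
  by_cases hs : x ∈ T.supp
  · obtain ⟨j, hj, hxj⟩ := hc.1 x hs
    rwa [Option.some_injective _ (hx.symm.trans hxj)]
  · simp [hc.2 x hs] at hx

theorem exists_isColoring_apply_eq {ι : Type*} {x : ι → Cube n} (hx : Function.Injective x)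
    {a : ι → Fin m} (ha : ∀ j, a j ∈ T (x j)) :
    ∃ c : ColoredSubset m n, T.IsColoring c ∧ ∀ j, c (x j) = some (a j) := by
  classical
  let c₀ : ColoredSubset m n := fun y ↦ if h : (T y).Nonempty then some h.choose else none
  refine ⟨Function.extend x (some ∘ a) c₀, ⟨fun y hy ↦ ?_, fun y hy ↦ ?_⟩,
    fun j ↦ hx.extend_apply _ _ j⟩
  · by_cases hyx : ∃ j, x j = y
    · obtain ⟨j, rfl⟩ := hyx
      exact ⟨a j, ha j, hx.extend_apply _ _ j⟩
    · have hne : (T y).Nonempty := nonempty_iff_ne_empty.2 hy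
      exact ⟨hne.choose, hne.choose_spec,
        by rw [Function.extend_apply' _ _ _ hyx]; exact dif_pos hne⟩
  · have hempty : T y = ∅ := not_not.1 hy
    have hyx : ¬∃ j, x j = y := by
      rintro ⟨j, rfl⟩
      exact notMem_empty _ (hempty ▸ ha j)
    rw [Function.extend_apply' _ _ _ hyx]
    exact dif_neg (not_nonempty_iff_eq_empty.2 hempty)

theorem valid_iff :
    T.Valid G ↔ ∀ g ∈ G, ∀ x : Fin g.length → Cube n, StrictMono x → ∃ j, g.get j ∉ T (x j) := by
  constructor
  · intro hT g hg x hx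
    by_contra! hmem
    obtain ⟨c, hc, hcx⟩ := exists_isColoring_apply_eq hx.injective hmem
    exact hT c hc g hg ⟨x, hx, hcx⟩
  · rintro h c hc g hg ⟨x, hx, hcx⟩
    obtain ⟨j, hj⟩ := h g hg x hx
    exact hj (hc.mem (hcx j))

theorem valid_empty (hG : [] ∉ G) : Valid G (fun _ ↦ ∅ : Template m n) :=
  valid_iff.2 fun _ hg _ _ ↦
    ⟨⟨0, List.length_pos_of_ne_nil fun h ↦ hG (h ▸ hg)⟩, notMem_empty _⟩

theorem mem_of_supportedOn {A : Set (Cube n)} (hTA : T.SupportedOn A) {x : Cube n} {i : Fin m}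
    (hi : i ∈ T x) : x ∈ A :=
  of_not_not fun hx ↦ notMem_empty i (hTA x hx ▸ hi)

theorem Valid.card_filter_mem_lt (hT : T.Valid G) {A : Set (Cube n)} (hA : IsChain (· ⊆ ·) A)
    (hTA : T.SupportedOn A) {l : ℕ} {i : Fin m} (hl : List.replicate l i ∈ G) :
    #{x | i ∈ T x} < l := by
  by_contra! hcard
  have hchain : IsChain (· ≤ ·) (({x | i ∈ T x} : Finset (Cube n)) : Set (Cube n)) :=
    hA.mono fun x hx ↦ mem_of_supportedOn hTA ((mem_filter_univ x).1 hx)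
  obtain ⟨x, hx, hxT⟩ := exists_strictMono_of_isChain hchain (List.length_replicate.trans_le hcard)
  obtain ⟨j, hj⟩ := valid_iff.1 hT _ hl x hx
  exact hj (by simpa using hxT j)

theorem card_filter_ne_empty_le {l : Fin m → ℕ} (hl : ∀ i, #{x | i ∈ T x} ≤ l i) :
    #{x | T x ≠ ∅} ≤ ∑ i, l i := by
  have hsub : ({x | T x ≠ ∅} : Finset (Cube n)) ⊆ univ.biUnion fun i ↦ {x | i ∈ T x} := by
    intro x hx
    obtain ⟨i, hi⟩ := nonempty_iff_ne_empty.2 ((mem_filter_univ x).1 hx)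
    exact mem_biUnion.2 ⟨i, mem_univ i, (mem_filter_univ x).2 hi⟩
  exact (card_le_card hsub).trans (card_biUnion_le.trans (sum_le_sum fun i _ ↦ hl i))

theorem entropy_eq_sum (β : Fin m → ℝ) : T.entropy β = ∑ x, colorEntropy β (T x) := rfl

theorem entropy_eq_sum_map_toList (β : Fin m → ℝ) :
    T.entropy β =
      ((({x | T x ≠ ∅} : Finset (Cube n)).toList.map T).map (colorEntropy β)).sum := by
  rw [List.map_map, sum_map_toList, entropy_eq_sum]
  refine (sum_subset (subset_univ _) fun x _ hx ↦ ?_).symm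
  rw [mem_filter_univ, not_not] at hx
  rw [hx, colorEntropy_empty]

end Template

section CriticalExponent

variable {m : ℕ} {G : Set (List (Fin m))}

theorem finite_chainEntropies (hsparse : IsSparse G) (β : Fin m → ℝ) :
    (chainEntropies G β).Finite := by
  choose l hl using hsparse
  refine ((List.finite_length_le (Finset (Fin m)) (∑ i, l i)).image
    fun L ↦ (L.map (colorEntropy β)).sum).subset ?_
  rintro _ ⟨n, T, hT, ⟨A, hA, hTA⟩, rfl⟩
  refine ⟨({x | T x ≠ ∅} : Finset (Cube n)).toList.map T, ?_, (T.entropy_eq_sum_map_toList β).symm⟩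
  rw [Set.mem_ofPred_eq, List.length_map, length_toList]
  exact Template.card_filter_ne_empty_le fun i ↦ (hT.card_filter_mem_lt hA hTA (hl i)).le

theorem zero_mem_chainEntropies (hG : [] ∉ G) (β : Fin m → ℝ) : 0 ∈ chainEntropies G β :=
  ⟨0, fun _ ↦ ∅, Template.valid_empty hG, ⟨∅, Set.pairwise_empty _, fun _ _ ↦ rfl⟩,
    (sum_eq_zero fun _ _ ↦ colorEntropy_empty).symm⟩

theorem isGreatest_omegaCrit (hG : [] ∉ G) (hsparse : IsSparse G) (β : Fin m → ℝ) :
    IsGreatest (chainEntropies G β) (omegaCrit G β) :=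
  have hfin := finite_chainEntropies hsparse β
  ⟨Set.Nonempty.csSup_mem ⟨0, zero_mem_chainEntropies hG β⟩ hfin,
    fun _ hw ↦ le_csSup hfin.bddAbove hw⟩

end CriticalExponent

/-! ### Weighted counting of the colored subsets of a template -/

section Subcolorings

variable {m n : ℕ} {G : Set (List (Fin m))} {β : Fin m → ℝ}

theorem weight_nonneg (hβ : ∀ i, 0 ≤ β i) (c : ColoredSubset m n) : 0 ≤ weight β c :=
  prod_nonneg fun x _ ↦ by cases c x <;> simp [hβ]

theorem measure_mono (hβ : ∀ i, 0 ≤ β i) {Λ Λ' : Finset (ColoredSubset m n)} (h : Λ ⊆ Λ') :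
    measure β Λ ≤ measure β Λ' :=
  sum_le_sum_of_subset_of_nonneg h fun c _ _ ↦ weight_nonneg hβ c

theorem mem_validSubsets {c : ColoredSubset m n} : c ∈ validSubsets G n ↔ IsValid G c :=
  Set.Finite.mem_toFinset _

namespace Template

variable {T : Template m n}

/-- The colored subsets whose elements `x` have a color in `T x`. Unlike in `IsColoring`, they need
not contain the whole support of `T`. -/
def subcolorings (T : Template m n) : Finset (ColoredSubset m n) :=
  Fintype.piFinset fun x ↦ (T x).insertNone

theorem mem_subcolorings {c : ColoredSubset m n} :
    c ∈ T.subcolorings ↔ ∀ x i, c x = some i → i ∈ T x := by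
  simp only [subcolorings, Fintype.mem_piFinset, mem_insertNone, Option.mem_def]

theorem measure_subcolorings (hβ : ∀ i, 0 ≤ β i) :
    measure β T.subcolorings = Real.exp (T.entropy β) := by
  calc measure β T.subcolorings = ∏ x, ∑ o ∈ (T x).insertNone, o.elim 1 β :=
        (prod_univ_sum (fun x ↦ (T x).insertNone) fun _ (o : Option (Fin m)) ↦ o.elim 1 β).symm
    _ = ∏ x, Real.exp (colorEntropy β (T x)) :=
        prod_congr rfl fun x _ ↦ by
          rw [exp_colorEntropy hβ, sum_insertNone, Option.elim_none]
          simp only [Option.elim_some]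
    _ = Real.exp (T.entropy β) := (Real.exp_sum _ _).symm

theorem Valid.subcolorings_subset (hT : T.Valid G) : T.subcolorings ⊆ validSubsets G n := by
  intro c hc
  refine mem_validSubsets.2 fun g hg ⟨x, hx, hxc⟩ ↦ ?_
  obtain ⟨j, hj⟩ := valid_iff.1 hT g hg x hx
  exact hj (mem_subcolorings.1 hc _ _ (hxc j))

theorem Valid.exp_entropy_le_measure (hβ : ∀ i, 0 ≤ β i) (hT : T.Valid G) :
    Real.exp (T.entropy β) ≤ measure β (validSubsets G n) :=
  measure_subcolorings hβ ▸ measure_mono hβ hT.subcolorings_subset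

end Template

theorem measure_validSubsets_pos (hG : [] ∉ G) (hβ : ∀ i, 0 ≤ β i) (n : ℕ) :
    0 < measure β (validSubsets G n) :=
  (Real.exp_pos _).trans_le ((Template.valid_empty hG).exp_entropy_le_measure hβ)

end Subcolorings

/-! ### Entropy of sets of labeled elements with few conflicts -/

section ColorsOf

variable {m n : ℕ} {γ : Type*} {B S : Finset (Cube n × Fin m × γ)} {β : Fin m → ℝ}

/-- The template of the colors which occur in a set of elements labeled by colors and further
data. -/
def colorsOf (B : Finset (Cube n × Fin m × γ)) : Template m n :=
  fun x ↦ {v ∈ B | v.1 = x}.image fun v ↦ v.2.1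

theorem mem_colorsOf {x : Cube n} {i : Fin m} : i ∈ colorsOf B x ↔ ∃ s, (x, i, s) ∈ B := by
  simp only [colorsOf, mem_image, mem_filter]
  constructor
  · rintro ⟨⟨y, j, s⟩, ⟨h, rfl⟩, rfl⟩
    exact ⟨s, h⟩
  · rintro ⟨s, h⟩
    exact ⟨_, ⟨h, rfl⟩, rfl⟩

theorem colorsOf_supportedOn (B : Finset (Cube n × Fin m × γ)) :
    (colorsOf B).SupportedOn (Prod.fst '' (B : Set (Cube n × Fin m × γ))) := by
  refine fun x hx ↦ eq_empty_of_forall_notMem fun i hi ↦ hx ?_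
  obtain ⟨s, hs⟩ := mem_colorsOf.1 hi
  exact ⟨_, hs, rfl⟩

theorem entropy_colorsOf_filter (p : Cube n → Prop) [DecidablePred p] :
    (colorsOf {v ∈ B | p v.1}).entropy β = ∑ x with p x, colorEntropy β (colorsOf B x) := by
  rw [Template.entropy_eq_sum, sum_filter]
  refine sum_congr rfl fun x _ ↦ ?_
  have hmem (i : Fin m) : i ∈ colorsOf {v ∈ B | p v.1} x ↔ i ∈ colorsOf B x ∧ p x := by
    simp only [mem_colorsOf, mem_filter, exists_and_right]
  split_ifs with hx
  · rw [ext fun i ↦ (hmem i).trans (and_iff_left hx)]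
  · rw [eq_empty_of_forall_notMem fun i hi ↦ hx ((hmem i).1 hi).2, colorEntropy_empty]

theorem entropy_colorsOf_union_le [DecidableEq γ] (hβ : ∀ i, 0 ≤ β i) :
    (colorsOf (B ∪ S)).entropy β ≤ (colorsOf B).entropy β + colorEntropy β univ * #S := by
  have hcard : (#S : ℝ) = ∑ x : Cube n, (#{v ∈ S | v.1 = x} : ℝ) := by
    exact_mod_cast card_eq_sum_card_fiberwise (f := Prod.fst) (t := univ) fun _ _ ↦ mem_univ _
  rw [hcard, mul_sum, Template.entropy_eq_sum, Template.entropy_eq_sum, ← sum_add_distrib]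
  refine sum_le_sum fun x _ ↦ ?_
  obtain h | h := {v ∈ S | v.1 = x}.eq_empty_or_nonempty
  · simp [colorsOf, filter_union, h]
  · have h₁ : (1 : ℝ) ≤ #{v ∈ S | v.1 = x} := by exact_mod_cast h.card_pos
    exact (colorEntropy_mono hβ (subset_univ _)).trans <|
      (le_mul_of_one_le_right (colorEntropy_nonneg hβ univ) h₁).trans <|
        le_add_of_nonneg_left (colorEntropy_nonneg hβ _)

theorem entropy_colorsOf_le_mul_card (hβ : ∀ i, 0 ≤ β i) (B : Finset (Cube n × Fin m × γ)) :
    (colorsOf B).entropy β ≤ colorEntropy β univ * #B := by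
  classical
  simpa [colorsOf, Template.entropy] using entropy_colorsOf_union_le (B := ∅) (S := B) hβ

end ColorsOf

section Conflict

variable {m n : ℕ} {G : Set (List (Fin m))} {β : Fin m → ℝ}
  {B : Finset (Cube n × RefinedColor (Fin m))} {Q : Finset (RefinedColor (Fin m))}

theorem valid_colorsOf (hG : [] ∉ G) (hB : ∀ v ∈ B, v.2 ∈ admissible G)
    (hconf : ∀ u ∈ B, ∀ v ∈ B, u.1 < v.1 → ¬Conflict u.2 v.2) : (colorsOf B).Valid G := by
  refine Template.valid_iff.2 fun g hg x hx ↦ ?_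
  by_contra! hmem
  simp_rw [mem_colorsOf] at hmem
  choose s hs using hmem
  let L : List (RefinedColor (Fin m)) := List.ofFn fun j ↦ (g.get j, s j)
  have hLg : L.map Prod.fst = g := by rw [List.map_ofFn]; exact List.ofFn_get g
  have hL : Avoids G (L.map Prod.fst) := by
    refine avoids_map_fst ?_ ?_ ?_
    · intro h
      rw [h, List.map_nil] at hLg
      exact hG (hLg ▸ hg)
    · intro q hq
      obtain ⟨j, rfl⟩ := (List.mem_ofFn' _ _).1 hq
      exact hB _ (hs j)
    · exact List.pairwise_ofFn.2 fun i j hij ↦ hconf _ (hs i) _ (hs j) (hx hij)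
  rw [hLg] at hL
  exact hL.notMem hg

theorem entropy_colorsOf_le_of_isChain (hG : [] ∉ G) (hsparse : IsSparse G) (hβ : ∀ i, 0 ≤ β i)
    (hQ : (Q : Set (RefinedColor (Fin m))) ⊆ admissible G) (hB : ∀ v ∈ B, v.2 ∈ Q)
    (hchain : IsChain (· ≤ ·) (Prod.fst '' (B : Set (Cube n × RefinedColor (Fin m))))) :
    (colorsOf B).entropy β ≤
      omegaCrit G β + colorEntropy β univ * (#Q + 1) * #(conflictPairs Conflict B) := by
  have hmax := (isGreatest_omegaCrit hG hsparse β).2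
  have hL : 0 ≤ colorEntropy β univ := colorEntropy_nonneg hβ univ
  obtain h | h := (conflictPairs Conflict B).eq_empty_or_nonempty
  · have hvalid : (colorsOf B).Valid G :=
      valid_colorsOf hG (fun v hv ↦ hQ (hB v hv)) fun u hu v hv huv hc ↦
        notMem_empty (u, v) (h ▸ mem_conflictPairs.2 ⟨⟨hu, hv⟩, huv, hc⟩)
    rw [h, card_empty, Nat.cast_zero, mul_zero, add_zero]
    exact hmax ⟨n, colorsOf B, hvalid, ⟨_, hchain, colorsOf_supportedOn B⟩, rfl⟩
  · have hcard : #B ≤ (#Q + 1) * #(conflictPairs Conflict B) := by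
      have := card_le_card_add_card_conflictPairs (R := Conflict)
        (fun q hq ↦ conflict_self hsparse (hQ hq)) hB hchain
      nlinarith [h.card_pos]
    calc (colorsOf B).entropy β ≤ colorEntropy β univ * #B := entropy_colorsOf_le_mul_card hβ B
      _ ≤ colorEntropy β univ * ((#Q + 1) * #(conflictPairs Conflict B)) := by
        gcongr
        exact_mod_cast hcard
      _ ≤ _ := by
        rw [mul_assoc]
        exact le_add_of_nonneg_left (hmax (zero_mem_chainEntropies hG β))

open Classical in
theorem entropy_colorsOf_le (hG : [] ∉ G) (hsparse : IsSparse G) (hβ : ∀ i, 0 ≤ β i)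
    (hQ : (Q : Set (RefinedColor (Fin m))) ⊆ admissible G) (hB : ∀ v ∈ B, v.2 ∈ Q)
    (hB' : ∀ v ∈ B, v.1.Nonempty ∧ v.1 ≠ univ) {d : ℕ}
    (hdeg : ∀ v ∈ B, #{u ∈ B | (conflictGraph Conflict).Adj v u} ≤ d) (hn : 0 < n)
    (hd : 2 * d ≤ n) :
    (colorsOf B).entropy β ≤ n.choose (n / 2) *
      (omegaCrit G β + colorEntropy β univ * (#Q + 1) * (2 * #Q * (d / n))) := by
  have hprefix (f : Numbering (Fin n)) : ∑ x with f.IsPrefix x, colorEntropy β (colorsOf B x) ≤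
      omegaCrit G β + colorEntropy β univ * (#Q + 1) *
        #(conflictPairs Conflict {v ∈ B | f.IsPrefix v.1}) := by
    rw [← entropy_colorsOf_filter]
    refine entropy_colorsOf_le_of_isChain hG hsparse hβ hQ
      (fun v hv ↦ hB v (mem_of_mem_filter v hv)) ((isChain_setOf_isPrefix f).mono ?_)
    rintro _ ⟨v, hv, rfl⟩
    exact (mem_filter.1 hv).2
  have hL : 0 ≤ colorEntropy β univ := colorEntropy_nonneg hβ univ
  have : Nonempty (Numbering (Fin n)) := ⟨Fintype.equivFin _⟩
  have : NeZero n := ⟨hn.ne'⟩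
  calc (colorsOf B).entropy β
      ≤ n.choose (n / 2) *
          𝔼 f : Numbering (Fin n), ∑ x with f.IsPrefix x, colorEntropy β (colorsOf B x) := by
        simpa only [Fintype.card_fin, Template.entropy_eq_sum] using
          sum_le_choose_middle_mul_expect fun x : Cube n ↦ colorEntropy_nonneg hβ (colorsOf B x)
    _ ≤ n.choose (n / 2) * 𝔼 f : Numbering (Fin n), (omegaCrit G β +
          colorEntropy β univ * (#Q + 1) *
            #(conflictPairs Conflict {v ∈ B | f.IsPrefix v.1})) := by
        gcongr with f
        exact hprefix f
    _ = n.choose (n / 2) * (omegaCrit G β + colorEntropy β univ * (#Q + 1) *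
          𝔼 f : Numbering (Fin n), (#(conflictPairs Conflict {v ∈ B | f.IsPrefix v.1}) : ℝ)) := by
        rw [expect_add_distrib, Fintype.expect_const, mul_expect]
    _ ≤ _ := by
        gcongr
        simpa only [Fintype.card_fin] using expect_card_conflictPairs_le
          (fun q hq ↦ conflict_self hsparse (hQ hq)) hB hB' hdeg (by rwa [Fintype.card_fin])

end Conflict

/-! ### The upper bound -/

theorem exp_le_one_add_pow {t : ℝ} (ht : 0 ≤ t) (ht₁ : t ≤ 1) (d : ℕ) :
    Real.exp (d * t / 2) ≤ (1 + t) ^ d := by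
  have hlog : t / 2 ≤ Real.log (1 + t) :=
    (Real.le_log_one_add_of_nonneg ht).trans' <| by
      rw [div_le_div_iff₀ two_pos (by positivity)]
      nlinarith
  rw [← Real.le_log_iff_exp_le (by positivity), Real.log_pow, mul_div_assoc]
  gcongr

/-- The choice is `t = n ^ (-2/3)` and `d ≈ n ^ (5/6)`: any exponents with `t` of smaller order than
`1 / √n` and `d` between `log n / t` and `n` would do. -/
theorem exists_container_parameters (M : ℝ) :
    ∃ (d : ℕ → ℕ) (t : ℕ → ℝ), (∀ n, 0 ≤ t n) ∧ Tendsto (fun n ↦ (d n / n : ℝ)) atTop (𝓝 0) ∧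
      Tendsto (fun n : ℕ ↦ t n * √(2 * n + 3)) atTop (𝓝 0) ∧
      ∀ᶠ n in atTop, M ≤ t n * (1 + t n) ^ d n := by
  let y (n : ℕ) : ℝ := (n : ℝ) ^ (6⁻¹ : ℝ)
  have hy6 (n : ℕ) : (n : ℝ) = y n ^ 6 :=
    (Real.rpow_inv_natCast_pow n.cast_nonneg (by norm_num : 6 ≠ 0)).symm
  have hy : Tendsto y atTop atTop :=
    (tendsto_rpow_atTop (by norm_num)).comp tendsto_natCast_atTop_atTop
  have hinv : Tendsto (fun n ↦ (y n)⁻¹) atTop (𝓝 0) := tendsto_inv_atTop_zero.comp hy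
  refine ⟨fun n ↦ ⌈y n ^ 5⌉₊, fun n ↦ (y n)⁻¹ ^ 4, fun n ↦ by positivity, ?_, ?_, ?_⟩
  · have hlim : Tendsto (fun n ↦ (y n)⁻¹ + (y n)⁻¹ ^ 6) atTop (𝓝 0) := by
      simpa using hinv.add (hinv.pow 6)
    refine squeeze_zero' (.of_forall fun n ↦ by positivity) ?_ hlim
    filter_upwards [hy.eventually_gt_atTop 0] with n hn
    rw [hy6 n, div_le_iff₀ (by positivity)]
    calc (⌈y n ^ 5⌉₊ : ℝ) ≤ y n ^ 5 + 1 := (Nat.ceil_lt_add_one (by positivity)).le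
      _ = ((y n)⁻¹ + (y n)⁻¹ ^ 6) * y n ^ 6 := by field_simp
  · have hlim : Tendsto (fun n ↦ √(2 * (y n)⁻¹ ^ 2 + 3 * (y n)⁻¹ ^ 8)) atTop (𝓝 0) := by
      simpa using (((hinv.pow 2).const_mul 2).add ((hinv.pow 8).const_mul 3)).sqrt
    refine hlim.congr' ?_
    filter_upwards [hy.eventually_gt_atTop 0] with n hn
    rw [hy6 n, ← Real.sqrt_sq (by positivity : 0 ≤ (y n)⁻¹ ^ 4), ← Real.sqrt_mul (by positivity)]
    congr 1
    field_simp
  · have hhalf : Tendsto (fun n ↦ y n / 2) atTop atTop := hy.atTop_div_const two_pos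
    have hlim : Tendsto (fun n ↦ (Real.exp (y n / 2) / (y n / 2) ^ 4) / 16) atTop atTop :=
      ((Real.tendsto_exp_div_pow_atTop 4).comp hhalf).atTop_div_const (by norm_num)
    filter_upwards [hy.eventually_ge_atTop 1, hlim.eventually_ge_atTop M] with n hn hM
    have ht₁ : (y n)⁻¹ ^ 4 ≤ 1 := pow_le_one₀ (by positivity) (inv_le_one_of_one_le₀ hn)
    calc M ≤ (Real.exp (y n / 2) / (y n / 2) ^ 4) / 16 := hM
      _ = (y n)⁻¹ ^ 4 * Real.exp (y n ^ 5 * (y n)⁻¹ ^ 4 / 2) := by field_simp; norm_num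
      _ ≤ (y n)⁻¹ ^ 4 * Real.exp (⌈y n ^ 5⌉₊ * (y n)⁻¹ ^ 4 / 2) := by
        gcongr
        exact Nat.le_ceil _
      _ ≤ (y n)⁻¹ ^ 4 * (1 + (y n)⁻¹ ^ 4) ^ ⌈y n ^ 5⌉₊ := by
        gcongr
        exact exp_le_one_add_pow (by positivity) ht₁ _

section UpperBound

variable {m n : ℕ} {G : Set (List (Fin m))} {β : Fin m → ℝ} {Q : Finset (RefinedColor (Fin m))}
  {d : ℕ} {t : ℝ}

theorem sum_weight_filter_refinement_subset_le (hβ : ∀ i, 0 ≤ β i)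
    (F : Finset (ColoredSubset m n)) (B : Finset (Cube n × RefinedColor (Fin m))) :
    ∑ c ∈ F with refinement c ⊆ B, weight β c ≤ Real.exp ((colorsOf B).entropy β) := by
  rw [← Template.measure_subcolorings hβ]
  refine measure_mono hβ fun c hc ↦ Template.mem_subcolorings.2 fun x i hxi ↦ ?_
  have hmem : (x, i, wordsAbove c x) ∈ refinement c := mem_refinement.2 ⟨hxi, rfl⟩
  exact mem_colorsOf.2 ⟨_, (mem_filter.1 hc).2 hmem⟩

open Classical in
theorem sum_weight_filter_refinement_subset_union_le (hG : [] ∉ G) (hsparse : IsSparse G)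
    (hβ : ∀ i, 0 ≤ β i) (hQ : (Q : Set (RefinedColor (Fin m))) ⊆ admissible G)
    {B : Finset (Cube n × RefinedColor (Fin m))} (hB : B ⊆ {∅, univ}ᶜ ×ˢ Q)
    (hdeg : ∀ v ∈ B, #{u ∈ B | (conflictGraph Conflict).Adj v u} ≤ d) (hn : 0 < n)
    (hd : 2 * d ≤ n) (F : Finset (ColoredSubset m n))
    (S : Finset (Cube n × RefinedColor (Fin m))) :
    ∑ c ∈ F with refinement c ⊆ B ∪ S, weight β c ≤
      Real.exp (n.choose (n / 2) *
        (omegaCrit G β + colorEntropy β univ * (#Q + 1) * (2 * #Q * (d / n)))) *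
      Real.exp (colorEntropy β univ) ^ #S := by
  have hBQ : ∀ v ∈ B, v.2 ∈ Q := fun v hv ↦ (mem_product.1 (hB hv)).2
  have hB' : ∀ v ∈ B, v.1.Nonempty ∧ v.1 ≠ univ := fun v hv ↦ by
    simpa [nonempty_iff_ne_empty] using (mem_product.1 (hB hv)).1
  refine (sum_weight_filter_refinement_subset_le hβ _ _).trans ?_
  rw [← Real.exp_nat_mul, ← Real.exp_add, mul_comm (#S : ℝ)]
  gcongr
  refine (entropy_colorsOf_union_le hβ).trans ?_
  gcongr
  exact entropy_colorsOf_le hG hsparse hβ hQ hBQ hB' hdeg hn hd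

theorem measure_validSubsets_le (hG : [] ∉ G) (hsparse : IsSparse G) (hβ : ∀ i, 0 ≤ β i)
    (hQ : (Q : Set (RefinedColor (Fin m))) = admissible G) (hn : 0 < n) (hd : 2 * d ≤ n)
    (ht : 0 ≤ t) (htd : Real.exp (colorEntropy β univ) ≤ t * (1 + t) ^ d) :
    measure β (validSubsets G n) ≤
      Real.exp (n.choose (n / 2) *
        (omegaCrit G β + colorEntropy β univ * (#Q + 1) * (2 * #Q * (d / n)))) *
      Real.exp (colorEntropy β univ) ^ (2 * #Q) * (1 + t) ^ (2 ^ n * #Q) := by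
  classical
  have hL : 1 ≤ Real.exp (colorEntropy β univ) := Real.one_le_exp (colorEntropy_nonneg hβ univ)
  let A : Finset (Cube n × RefinedColor (Fin m)) := {∅, univ}ᶜ ×ˢ Q
  let S : Finset (Cube n × RefinedColor (Fin m)) := {∅, univ} ×ˢ Q
  have hA : #A ≤ 2 ^ n * #Q := by
    rw [card_product]
    gcongr
    simpa using card_le_univ ({∅, univ}ᶜ : Finset (Cube n))
  have hS : #S ≤ 2 * #Q := by
    rw [card_product]
    gcongr
    exact card_le_two
  have hrefinement : ∀ c ∈ validSubsets G n, refinement c ⊆ A ∪ S := fun c hc v hv ↦ by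
    have hvQ := snd_mem_admissible_of_mem_refinement (mem_validSubsets.1 hc) hv
    rw [← hQ, mem_coe] at hvQ
    rw [← union_product, union_comm, union_compl, mem_product]
    exact ⟨mem_univ _, hvQ⟩
  calc measure β (validSubsets G n)
      = ∑ c ∈ validSubsets G n with refinement c ⊆ A ∪ S, weight β c := by
        rw [filter_true_of_mem hrefinement, measure]
    _ ≤ _ := sum_subset_union_le_mul_pow (fun c _ ↦ isIndepSet_refinement)
        (fun c _ ↦ weight_nonneg hβ c) hL ht htd
        (fun B hB hdeg ↦ sum_weight_filter_refinement_subset_union_le hG hsparse hβ hQ.subset hB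
          hdeg hn hd _) S
    _ ≤ _ := by
        gcongr
        exact le_add_of_nonneg_right ht

theorem log_measure_validSubsets_div_le (hG : [] ∉ G) (hsparse : IsSparse G) (hβ : ∀ i, 0 ≤ β i)
    (hQ : (Q : Set (RefinedColor (Fin m))) = admissible G) (hn : 0 < n) (hd : 2 * d ≤ n)
    (ht : 0 ≤ t) (htd : Real.exp (colorEntropy β univ) ≤ t * (1 + t) ^ d) :
    Real.log (measure β (validSubsets G n)) / n.choose (n / 2) ≤
      omegaCrit G β + colorEntropy β univ * (#Q + 1) * (2 * #Q * (d / n)) +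
        2 * #Q * colorEntropy β univ / n.choose (n / 2) + #Q * (t * √(2 * n + 3)) := by
  have hC : (0 : ℝ) < n.choose (n / 2) := Nat.cast_pos.2 (Nat.choose_pos (n.div_le_self 2))
  have hbound := (Real.log_le_log (measure_validSubsets_pos hG hβ n)
    (measure_validSubsets_le hG hsparse hβ hQ hn hd ht htd))
  rw [Real.log_mul (by positivity) (by positivity), Real.log_mul (by positivity) (by positivity),
    Real.log_exp, Real.log_pow, Real.log_exp, Real.log_pow] at hbound
  have hlog : Real.log (1 + t) ≤ t := (Real.log_le_sub_one_of_pos (by positivity)).trans (by simp)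
  have hlog₀ : 0 ≤ Real.log (1 + t) := Real.log_nonneg (le_add_of_nonneg_right ht)
  rw [div_le_iff₀ hC]
  calc _ ≤ _ := hbound
    _ ≤ n.choose (n / 2) *
          (omegaCrit G β + colorEntropy β univ * (#Q + 1) * (2 * #Q * (d / n))) +
        2 * #Q * colorEntropy β univ + √(2 * n + 3) * n.choose (n / 2) * #Q * t := by
      push_cast
      gcongr
      exact two_pow_le_sqrt_mul_choose_middle n
    _ = _ := by field_simp

end UpperBound

theorem exists_tendsto_and_log_measure_div_le {m : ℕ} {G : Set (List (Fin m))} {β : Fin m → ℝ}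
    (hG : [] ∉ G) (hsparse : IsSparse G) (hβ : ∀ i, 0 ≤ β i) :
    ∃ u : ℕ → ℝ, Tendsto u atTop (𝓝 (omegaCrit G β)) ∧
      ∀ᶠ n in atTop, Real.log (measure β (validSubsets G n)) / n.choose (n / 2) ≤ u n := by
  obtain ⟨Q, hQ⟩ := (finite_admissible hsparse).exists_finset_coe
  obtain ⟨d, t, ht, hdn, htn, htd⟩ := exists_container_parameters (Real.exp (colorEntropy β univ))
  refine ⟨fun n ↦ omegaCrit G β + colorEntropy β univ * (#Q + 1) * (2 * #Q * (d n / n)) +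
    2 * #Q * colorEntropy β univ / n.choose (n / 2) + #Q * (t n * √(2 * n + 3)), ?_, ?_⟩
  · simpa using (((hdn.const_mul _).const_mul _).const_add _ |>.add
      (tendsto_const_nhds.div_atTop tendsto_choose_middle_atTop)).add (htn.const_mul _)
  · filter_upwards [eventually_gt_atTop 0, hdn.eventually_le_const one_half_pos, htd]
      with n hn hd htd
    refine log_measure_validSubsets_div_le hG hsparse hβ hQ hn ?_ (ht n) htd
    rw [div_le_div_iff₀ (Nat.cast_pos.2 hn) two_pos] at hd
    exact_mod_cast (by linarith : (2 * d n : ℝ) ≤ n)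

/-! ### The lower bound -/

section LowerBound

variable {m n N : ℕ} {G : Set (List (Fin m))} {β : Fin m → ℝ} {T : Template m N}

theorem lt_of_isChain_of_card_lt {α : Type*} {A : Set (Finset α)} (hA : IsChain (· ⊆ ·) A)
    {x y : Finset α} (hx : x ∈ A) (hy : y ∈ A) (hxy : #x < #y) : x < y :=
  (hA.total hx hy).elim (fun h ↦ h.ssubset_of_ne fun h' ↦ hxy.ne (h' ▸ rfl))
    fun h ↦ absurd (card_le_card h) hxy.not_ge

theorem injOn_card_of_isChain {α : Type*} {A : Set (Finset α)} (hA : IsChain (· ⊆ ·) A) :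
    A.InjOn card := fun _ hx _ hy hxy ↦
  (hA.total hx hy).elim (fun h ↦ eq_of_subset_of_card_le h hxy.ge)
    fun h ↦ (eq_of_subset_of_card_le h hxy.le).symm

/-- The template on `𝒫([n])` which uses the colors of the elements of `T` of cardinality `a` on the
whole layer of the sets of cardinality `n / 2 + a`. -/
def Template.spread (T : Template m N) (n : ℕ) : Template m n :=
  fun y ↦ ({x | n / 2 + #x = #y} : Finset (Cube N)).biUnion T

theorem Template.mem_spread {y : Cube n} {i : Fin m} :
    i ∈ T.spread n y ↔ ∃ x, n / 2 + #x = #y ∧ i ∈ T x := by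
  simp only [spread, mem_biUnion, mem_filter_univ]

theorem Template.Valid.spread (hT : T.Valid G) {A : Set (Cube N)} (hA : IsChain (· ⊆ ·) A)
    (hTA : T.SupportedOn A) (n : ℕ) : (T.spread n).Valid G := by
  refine valid_iff.2 fun g hg y hy ↦ ?_
  by_contra! hmem
  simp_rw [mem_spread] at hmem
  choose x hcard hx using hmem
  have hxmono : StrictMono x := fun i j hij ↦
    lt_of_isChain_of_card_lt hA (mem_of_supportedOn hTA (hx i)) (mem_of_supportedOn hTA (hx j)) <|
      by simpa [← hcard] using card_lt_card (hy hij)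
  obtain ⟨j, hj⟩ := valid_iff.1 hT g hg x hxmono
  exact hj (hx j)

theorem Template.sum_colorEntropy_le_spread (hβ : ∀ i, 0 ≤ β i) {A : Set (Cube N)}
    (hA : IsChain (· ⊆ ·) A) (hTA : T.SupportedOn A) (y : Cube n) :
    ∑ x with n / 2 + #x = #y, colorEntropy β (T x) ≤ colorEntropy β (T.spread n y) := by
  by_cases h : ∃ x ∈ A, n / 2 + #x = #y
  · obtain ⟨x, hxA, hxy⟩ := h
    rw [sum_eq_single_of_mem x ((mem_filter_univ x).2 hxy)]
    · exact colorEntropy_mono hβ (subset_biUnion_of_mem T ((mem_filter_univ x).2 hxy))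
    · intro z hz hzx
      have hzy := (mem_filter_univ z).1 hz
      have hzA : z ∉ A := fun hzA ↦ hzx (injOn_card_of_isChain hA hzA hxA (by lia))
      rw [hTA z hzA, colorEntropy_empty]
  · push Not at h
    rw [sum_eq_zero fun x hx ↦ ?_]
    · exact colorEntropy_nonneg hβ _
    · rw [hTA x fun hxA ↦ h x hxA ((mem_filter_univ x).1 hx), colorEntropy_empty]

theorem Template.sum_choose_mul_colorEntropy_le_entropy_spread (hβ : ∀ i, 0 ≤ β i)
    {A : Set (Cube N)} (hA : IsChain (· ⊆ ·) A) (hTA : T.SupportedOn A) (n : ℕ) :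
    ∑ x, (n.choose (n / 2 + #x) : ℝ) * colorEntropy β (T x) ≤ (T.spread n).entropy β := by
  have hlayer (a : ℕ) : #{y : Cube n | a = #y} = n.choose a := by
    simp_rw [eq_comm (a := a)]
    rw [univ_filter_card_eq, card_powersetCard, card_univ, Fintype.card_fin]
  calc ∑ x, (n.choose (n / 2 + #x) : ℝ) * colorEntropy β (T x)
      = ∑ x, ∑ y : Cube n with n / 2 + #x = #y, colorEntropy β (T x) := by
        simp only [sum_const, hlayer, nsmul_eq_mul]
    _ = ∑ y : Cube n, ∑ x with n / 2 + #x = #y, colorEntropy β (T x) :=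
        sum_comm' fun x y ↦ by simp only [mem_univ, mem_filter_univ, true_and, and_true]
    _ ≤ (T.spread n).entropy β := sum_le_sum fun y _ ↦ sum_colorEntropy_le_spread hβ hA hTA y

theorem exists_tendsto_and_le_log_measure_div (hG : [] ∉ G) (hsparse : IsSparse G)
    (hβ : ∀ i, 0 ≤ β i) :
    ∃ u : ℕ → ℝ, Tendsto u atTop (𝓝 (omegaCrit G β)) ∧
      ∀ n, u n ≤ Real.log (measure β (validSubsets G n)) / n.choose (n / 2) := by
  obtain ⟨N, T, hT, ⟨A, hA, hTA⟩, hω⟩ := (isGreatest_omegaCrit hG hsparse β).1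
  refine ⟨fun n ↦ ∑ x, (n.choose (n / 2 + #x) : ℝ) / n.choose (n / 2) * colorEntropy β (T x),
    ?_, fun n ↦ ?_⟩
  · rw [hω, T.entropy_eq_sum]
    refine tendsto_finsetSum _ fun x _ ↦ ?_
    simpa only [one_mul] using (tendsto_choose_div_choose_middle #x).mul_const _
  · have hC : (0 : ℝ) < n.choose (n / 2) := Nat.cast_pos.2 (Nat.choose_pos (n.div_le_self 2))
    rw [le_div_iff₀ hC, Real.le_log_iff_exp_le (measure_validSubsets_pos hG hβ n), sum_mul]
    refine (Real.exp_le_exp.2 ?_).trans ((hT.spread hA hTA n).exp_entropy_le_measure hβ)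
    refine (Template.sum_choose_mul_colorEntropy_le_entropy_spread hβ hA hTA n).trans' ?_
    exact (sum_congr rfl fun x _ ↦ by field_simp).le

end LowerBound

section Asymptotics

variable {m n : ℕ} {G : Set (List (Fin m))} {β : Fin m → ℝ}

theorem tendsto_log_measure_div (hG : [] ∉ G) (hsparse : IsSparse G) (hβ : ∀ i, 0 ≤ β i) :
    Tendsto (fun n : ℕ ↦ Real.log (measure β (validSubsets G n)) / n.choose (n / 2)) atTop
      (𝓝 (omegaCrit G β)) := by
  obtain ⟨u, hu, hle⟩ := exists_tendsto_and_le_log_measure_div hG hsparse hβ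
  obtain ⟨v, hv, hge⟩ := exists_tendsto_and_log_measure_div_le hG hsparse hβ
  exact tendsto_of_tendsto_of_tendsto_of_le_of_le' hu hv (.of_forall hle) hge

theorem Template.valid_singleton {i : Fin m} (hG : [] ∉ G) (hi : [i] ∉ G) :
    Valid G (fun _ ↦ {i} : Template m 0) := by
  refine valid_iff.2 fun g hg x hx ↦ ?_
  by_contra! hmem
  have hlen : g.length ≤ 1 := by
    simpa using Fintype.card_le_of_injective x hx.injective
  match g with
  | [] => exact hG hg
  | [j] => exact hi (mem_singleton.1 (hmem 0) ▸ hg)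
  | _ :: _ :: _ => simp at hlen

theorem log_one_add_le_omegaCrit (hG : [] ∉ G) (hsparse : IsSparse G) {i : Fin m}
    (hi : [i] ∉ G) : Real.log (1 + β i) ≤ omegaCrit G β :=
  (isGreatest_omegaCrit hG hsparse β).2
    ⟨0, fun _ ↦ {i}, Template.valid_singleton hG hi,
      ⟨Set.univ, (Set.subsingleton_of_subsingleton).isChain, fun x hx ↦ absurd trivial hx⟩,
      by simp [Template.entropy]⟩

theorem IsValid.singleton_notMem {c : ColoredSubset m n} (hc : IsValid G c) {x : Cube n}
    {i : Fin m} (hx : c x = some i) : [i] ∉ G := fun hi ↦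
  hc [i] hi ⟨fun _ ↦ x, Subsingleton.strictMono (α := Fin 1) _, fun j ↦ by simp [hx]⟩

theorem measure_validSubsets_eq_one (hG : [] ∉ G) (hsparse : IsSparse G) (hβ : ∀ i, 0 ≤ β i)
    (hω : omegaCrit G β = 0) (n : ℕ) : measure β (validSubsets G n) = 1 := by
  have hnone : (fun _ ↦ none) ∈ validSubsets G n :=
    mem_validSubsets.2 fun g hg ⟨_, _, hx⟩ ↦
      Option.some_ne_none _ (hx ⟨0, List.length_pos_of_ne_nil fun h ↦ hG (h ▸ hg)⟩).symm
  rw [measure, sum_eq_single_of_mem _ hnone, weight]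
  · exact prod_eq_one fun _ _ ↦ rfl
  · intro c hc hne
    obtain ⟨x, hx⟩ := Function.ne_iff.1 hne
    obtain ⟨i, hi⟩ := Option.ne_none_iff_exists'.1 hx
    have hlog : Real.log (1 + β i) ≤ 0 :=
      hω ▸ log_one_add_le_omegaCrit hG hsparse ((mem_validSubsets.1 hc).singleton_notMem hi)
    have hβi : β i = 0 := by
      rw [Real.log_nonpos_iff (by linarith [hβ i])] at hlog
      linarith [hβ i]
    exact prod_eq_zero (mem_univ x) (by rw [hi, Option.elim_some, hβi])

end Asymptotics

end ColoredChains

theorem mainTheorem1_general {m : ℕ} {G : Set (List (Fin m))} (hG : [] ∉ G)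
    (hsparse : ColoredChains.IsSparse G) {β : Fin m → ℝ} (hβ : ∀ i, 0 ≤ β i) :
    IsGreatest (ColoredChains.chainEntropies G β) (ColoredChains.omegaCrit G β) ∧
    ∃ ε : ℕ → ℝ, Tendsto ε atTop (𝓝 0) ∧
      ∀ n : ℕ, ColoredChains.measure β (ColoredChains.validSubsets G n) =
        Real.exp (ColoredChains.omegaCrit G β * (n.choose (n / 2) : ℝ) * (1 + ε n)) := by
  refine ⟨ColoredChains.isGreatest_omegaCrit hG hsparse β, ?_⟩
  by_cases hω : ColoredChains.omegaCrit G β = 0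
  · refine ⟨0, tendsto_const_nhds, fun n ↦ ?_⟩
    rw [ColoredChains.measure_validSubsets_eq_one hG hsparse hβ hω, hω, zero_mul, zero_mul,
      Real.exp_zero]
  · refine ⟨fun n ↦ Real.log (ColoredChains.measure β (ColoredChains.validSubsets G n)) /
      n.choose (n / 2) / ColoredChains.omegaCrit G β - 1, ?_, fun n ↦ ?_⟩
    · simpa only [div_self hω, sub_self] using
        ((ColoredChains.tendsto_log_measure_div hG hsparse hβ).div_const
          (ColoredChains.omegaCrit G β)).sub_const 1
    · have hC : (n.choose (n / 2) : ℝ) ≠ 0 :=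
        Nat.cast_ne_zero.2 (Nat.choose_pos (n.div_le_self 2)).ne'
      rw [add_sub_cancel, div_div, mul_comm (n.choose (n / 2) : ℝ),
        mul_div_cancel₀ _ (mul_ne_zero hω hC),
        Real.exp_log (ColoredChains.measure_validSubsets_pos hG hβ n)]

theorem mainTheorem1 (m k : ℕ) (G : Set (List (Fin m)))
    (hG : ∀ g ∈ G, 2 ≤ g.length ∧ g.length ≤ k)
    (hsparse : ColoredChains.IsSparse G)
    (β : Fin m → ℝ) (hβ : ∀ i, 0 < β i) :
    IsGreatest (ColoredChains.chainEntropies G β) (ColoredChains.omegaCrit G β) ∧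
    ∃ ε : ℕ → ℝ, Tendsto ε atTop (𝓝 0) ∧
      ∀ n : ℕ, ColoredChains.measure β (ColoredChains.validSubsets G n) =
        Real.exp (ColoredChains.omegaCrit G β * (n.choose (n / 2) : ℝ) * (1 + ε n)) :=
  mainTheorem1_general (fun h ↦ by simpa using (hG _ h).1) hsparse fun i ↦ (hβ i).le
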